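/- Let $\varepsilon,l,c\in\mathbb R$ satisfy $\varepsilon\in(0,1)$, $1>l>\max(1-\varepsilon,\varepsilon)$ and $0\in I:=[c,c+l)$. Let $I_1=[c,c+l-1+\varepsilon)$, $I_2=[c+l-1+\varepsilon,c+\varepsilon)$, $I_3=[c+\varepsilon,c+l)$, and let $T:I\to I$ be the exchange of three intervals $T(x)=x+1-\varepsilon$ on $I_1$, $T(x)=x+1-2\varepsilon$ on $I_2$, $T(x)=x-\varepsilon$ on $I_3$. Let $u=(u_n)_{n\in\mathbb Z}$ be the pointed bidirectional infinite word over $\{1,2,3\}$ with $u_n=i$ if $T^n(0)\in I_i$, and assume that $u$ is non-degenerate, i.e. that the orbits $\{T^n(x)\mid n\in\mathbb Z\}$ of the two discontinuity points $x=c+l-1+\varepsilon$ and $x=c+\varepsilon$ are infinite and disjoint. For an interval $J\subset I$ of positive length and $z\in J$, let the return time $r(z)$ be the least integer $i\ge 1$ with $T^i(z)\in J$, let $T_J(z)=T^{r(z)}(z)$ be the first return map, and let the return name of $z$ be the word $v_0v_1\cdots v_{r(z)-1}$ with $v_i=X$ if $T^i(z)\in I_X$. Consider the properties P1. $T_J$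 is homothetic with $T$: for some $\nu\in(-1,1)$, $\nu\ne0$, one has $J=\nu I$ and $T_J(x)=\nu T(x/\nu)$ for all $x\in J$; P2. the set of return names of points of $J$ has exactly three elements. A substitution $\varphi$ over $\{1,2,3\}$ (an endomorphism of the free monoid of finite words) is primitive if for some $n$ the word $\varphi^n(a)$ contains $b$ for all letters $a,b$; $u$ is invariant under $\varphi$ if $\cdots\varphi(u_{-2})\varphi(u_{-1})|\varphi(u_0)\varphi(u_1)\cdots=u$ as pointed words. Then there exists a primitive substitution under which $u$ is invariant if and only if there exists an interval $J=[a,b)\subset I$, $a<b$, with $0\in J$ and with properties P1 and P2. The equivalence also holds if intervals of both forms $J=[a,b)$ and $J=(a,b]$ are admitted on the right-hand side. -/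

import Mathlib

open Set

noncomputable section

namespace ThreeIet

/-! ### Words and substitutions -/

/-- The factor `u_i u_{i+1} ⋯ u_{i+n-1}` of the pointed bidirectional infinite word `u`. -/
def factor {A : Type*} (u : ℤ → A) (i : ℤ) (n : ℕ) : FreeMonoid A :=
  FreeMonoid.ofList ((List.range n).map fun k => u (i + k))

/-- A substitution over the alphabet `A`: an endomorphism of the free monoid of finite words. -/
abbrev Substitution (A : Type*) := FreeMonoid A →* FreeMonoid A

/-- `φ` is primitive: for some `n`, the word `φ^n(a)` contains `b`, for all letters `a`, `b`. -/
def IsPrimitive {A : Type*} (φ : Substitution A) : Prop :=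
  ∃ n : ℕ, ∀ a b : A, b ∈ (φ^[n] (FreeMonoid.of a)).toList

/-- `⋯φ(u_{-2})φ(u_{-1})|φ(u_0)φ(u_1)φ(u_2)⋯` is (infinite in both directions and) equal to `v`,
with the same position of the origin: for every `m`, the word `φ(u_0 ⋯ u_{m-1})` is the factor of
`v` that starts at the origin, and `φ(u_{-m} ⋯ u_{-1})` is the one that ends at the origin. -/
def IsImage {A : Type*} (φ : Substitution A) (u v : ℤ → A) : Prop :=
  (∀ N : ℕ, ∃ m : ℕ, N ≤ (φ (factor u 0 m)).length) ∧
  (∀ N : ℕ, ∃ m : ℕ, N ≤ (φ (factor u (-(m : ℤ)) m)).length) ∧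
  (∀ m : ℕ, φ (factor u 0 m) = factor v 0 (φ (factor u 0 m)).length) ∧
  (∀ m : ℕ, φ (factor u (-(m : ℤ)) m) =
    factor v (-((φ (factor u (-(m : ℤ)) m)).length : ℤ)) (φ (factor u (-(m : ℤ)) m)).length)

/-- `u` is invariant under `φ` (a fixed point of `φ`): `φ(u) = u`. -/
def IsInvariant {A : Type*} (φ : Substitution A) (u : ℤ → A) : Prop :=
  IsImage φ u u

/-! ### The exchange of three intervals on `[c, c + l)`

`I₁ = [c, c+l-1+ε)`, `I₂ = [c+l-1+ε, c+ε)`, `I₃ = [c+ε, c+l)`, with permutation (321).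
The letters `1, 2, 3` are the elements `0, 1, 2` of `Fin 3`. -/

/-- The letter of the interval `I₁`, `I₂`, `I₃` in which the point `x ∈ [c, c+l)` lies. -/
def letter (ε l c x : ℝ) : Fin 3 :=
  if x < c + l - 1 + ε then 0 else if x < c + ε then 1 else 2

/-- The exchange of three intervals; only its values on `[c, c+l)` matter. -/
def T (ε l c x : ℝ) : ℝ :=
  if x < c + l - 1 + ε then x + 1 - ε else if x < c + ε then x + 1 - 2 * ε else x - ε

/-- `u` codes the orbit of `0`: `u_n = i` if `T^n(0) ∈ I_i`, for all `n ∈ ℤ`. As `T` is a bijection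
of `[c, c+l)`, the sequence `x n = T^n(0)`, `n ∈ ℤ`, is the only one with the properties listed. -/
def IsCoding (ε l c : ℝ) (u : ℤ → Fin 3) : Prop :=
  ∃ x : ℤ → ℝ, x 0 = 0 ∧ (∀ n, x n ∈ Ico c (c + l)) ∧ (∀ n, x (n + 1) = T ε l c (x n)) ∧
    ∀ n, u n = letter ε l c (x n)

/-- The two-sided orbit `{T^n(x) | n ∈ ℤ}` of a point `x ∈ [c, c+l)`. -/
def orbit (ε l c x : ℝ) : Set ℝ :=
  {y | y ∈ Ico c (c + l) ∧ ∃ n : ℕ, (T ε l c)^[n] x = y ∨ (T ε l c)^[n] y = x}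

/-- The infinite distinct orbit condition (i.d.o.c.): the orbits of the two points that separate
the exchanged intervals are infinite and disjoint. -/
def IDOC (ε l c : ℝ) : Prop :=
  (orbit ε l c (c + l - 1 + ε)).Infinite ∧ (orbit ε l c (c + ε)).Infinite ∧
    Disjoint (orbit ε l c (c + l - 1 + ε)) (orbit ε l c (c + ε))

/-- `u` is a non-degenerate 3iet word with parameters `ε`, `l`, `c`. -/
def IsNondegenerateWord (ε l c : ℝ) (u : ℤ → Fin 3) : Prop :=
  IDOC ε l c ∧ IsCoding ε l c u

/-! ### First return map -/

/-- The return time of `z ∈ J`: the least `i ≥ 1` with `T^i(z) ∈ J`. (Such `i` exists for every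
interval `J` of positive length, by minimality of `T`.) -/
def returnTime (ε l c : ℝ) (J : Set ℝ) (z : ℝ) : ℕ :=
  sInf {i : ℕ | 0 < i ∧ (T ε l c)^[i] z ∈ J}

/-- The first return map `T_J`. -/
def firstReturn (ε l c : ℝ) (J : Set ℝ) (z : ℝ) : ℝ :=
  (T ε l c)^[returnTime ε l c J z] z

/-- The return name of `z ∈ J`: the word `v_0 v_1 ⋯ v_{r(z)-1}` with `v_i = X` if
`T^i(z) ∈ I_X`. -/
def returnName (ε l c : ℝ) (J : Set ℝ) (z : ℝ) : List (Fin 3) :=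
  (List.range (returnTime ε l c J z)).map fun i => letter ε l c ((T ε l c)^[i] z)

/-- P1: `T_J` is homothetic with `T`, with a ratio `ν ∈ (-1, 1)`: one has `J = ν[c, c+l)` and
`T_J(x) = ν T(x/ν)` for `x ∈ J`. -/
def P1 (ε l c : ℝ) (J : Set ℝ) : Prop :=
  ∃ ν : ℝ, ν ∈ Ioo (-1 : ℝ) 1 ∧ ν ≠ 0 ∧ J = (fun x => ν * x) '' Ico c (c + l) ∧
    ∀ x ∈ J, firstReturn ε l c J x = ν * T ε l c (x / ν)

/-- P2: there are exactly three return names of points of `J`. -/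
def P2 (ε l c : ℝ) (J : Set ℝ) : Prop :=
  (returnName ε l c J '' J).ncard = 3

end ThreeIet

end

namespace ThreeIet

open Filter Topology

/-- The translation by which `T` acts on the interval of a letter. -/
noncomputable def shift (ε : ℝ) : Fin 3 → ℝ := ![1 - ε, 1 - 2 * ε, -ε]

/-- The sum of `τ` over the letters of a word. -/
noncomputable def weight (τ : Fin 3 → ℝ) (w : FreeMonoid (Fin 3)) : ℝ := (w.toList.map τ).sum

/-- The coding of the first `n` points of the forward orbit of `x`. -/
noncomputable def code (ε l c x : ℝ) (n : ℕ) : FreeMonoid (Fin 3) :=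
  FreeMonoid.ofList ((List.range n).map fun i => letter ε l c ((T ε l c)^[i] x))

/-- The inequalities between the parameters. -/
structure IsExchange (ε l c : ℝ) : Prop where
  pos : 0 < ε
  lt_one : ε < 1
  l_lt : l < 1
  one_sub_lt : 1 - ε < l
  lt_l : ε < l

/-- The consequences of the i.d.o.c. in the form in which they are used. -/
structure IsRegular (ε l c : ℝ) : Prop extends IsExchange ε l c where
  irr : Irrational ε
  iterate_left_ne : ∀ n, (T ε l c)^[n] (c + l - 1 + ε) ≠ c + ε
  iterate_right_ne : ∀ n, (T ε l c)^[n] (c + ε) ≠ c + l - 1 + ε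

variable {ε l c : ℝ}

/-! ### Words -/

@[simp] theorem weight_one (τ : Fin 3 → ℝ) : weight τ 1 = 0 := by simp [weight]

theorem weight_mul (τ : Fin 3 → ℝ) (v w : FreeMonoid (Fin 3)) :
    weight τ (v * w) = weight τ v + weight τ w := by simp [weight]

@[simp] theorem weight_of (τ : Fin 3 → ℝ) (a : Fin 3) : weight τ (FreeMonoid.of a) = τ a := by
  simp [weight]

theorem weight_map (τ : Fin 3 → ℝ) (φ : Substitution (Fin 3)) (w : FreeMonoid (Fin 3)) :
    weight τ (φ w) = weight (fun a => weight τ (φ (FreeMonoid.of a))) w := by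
  induction w using FreeMonoid.inductionOn' with
  | one => simp
  | of_mul a w ih => simp [weight_mul, ih]

theorem weight_smul (τ : Fin 3 → ℝ) (r : ℝ) (w : FreeMonoid (Fin 3)) :
    weight (fun a => r * τ a) w = r * weight τ w := by
  induction w using FreeMonoid.inductionOn' with
  | one => simp
  | of_mul a w ih => simp [weight_mul, ih, mul_add]

theorem exists_weight_shift (w : FreeMonoid (Fin 3)) :
    ∃ (k : ℕ) (m : ℤ), w.length ≤ k ∧ weight (shift ε) w = k * (1 - ε) - m := by
  induction w using FreeMonoid.inductionOn' with
  | one => exact ⟨0, 0, by simp, by simp⟩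
  | of_mul a w ih =>
    obtain ⟨k, m, hk, hw⟩ := ih
    fin_cases a
    · refine ⟨k + 1, m, by simp; omega, ?_⟩
      rw [weight_mul, hw, weight_of]; simp [shift]; ring
    · refine ⟨k + 2, m + 1, by simp; omega, ?_⟩
      rw [weight_mul, hw, weight_of]; simp [shift]; ring
    · refine ⟨k + 1, m + 1, by simp; omega, ?_⟩
      rw [weight_mul, hw, weight_of]; simp [shift]; ring

theorem natCast_mul_one_sub_ne (h : Irrational ε) {k : ℕ} (hk : k ≠ 0) (m : ℤ) :
    (k : ℝ) * (1 - ε) - m ≠ 0 := by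
  have h1 : Irrational (1 - ε) := by simpa using h.ratCast_sub 1
  have h2 : Irrational ((k : ℝ) * (1 - ε)) := h1.natCast_mul hk
  intro h3
  exact h2.ne_int m (sub_eq_zero.1 h3)

theorem weight_shift_ne_zero (h : Irrational ε) {w : FreeMonoid (Fin 3)} (hw : w.length ≠ 0) :
    weight (shift ε) w ≠ 0 := by
  obtain ⟨k, m, hk, e⟩ := exists_weight_shift (ε := ε) w
  rw [e]
  exact natCast_mul_one_sub_ne h (by omega) m

@[simp] theorem length_code (x : ℝ) (n : ℕ) : (code ε l c x n).length = n := by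
  simp [code, FreeMonoid.length]

@[simp] theorem code_zero (x : ℝ) : code ε l c x 0 = 1 := rfl

theorem code_add (x : ℝ) (m n : ℕ) :
    code ε l c x (m + n) = code ε l c x m * code ε l c ((T ε l c)^[m] x) n := by
  simp only [code, ← FreeMonoid.ofList_append, List.range_add, List.map_append, List.map_map]
  congr 2
  apply List.map_congr_left
  intro i _
  simp [← Function.iterate_add_apply, add_comm]

@[simp] theorem code_one (x : ℝ) : code ε l c x 1 = FreeMonoid.of (letter ε l c x) := rfl

theorem code_succ (x : ℝ) (n : ℕ) :
    code ε l c x (n + 1) = FreeMonoid.of (letter ε l c x) * code ε l c (T ε l c x) n := by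
  rw [add_comm, code_add]; rfl

theorem code_eq_of_le {x y : ℝ} {k n : ℕ} (h : code ε l c x n = code ε l c y n) (hk : k ≤ n) :
    code ε l c x k = code ε l c y k := by
  obtain ⟨j, rfl⟩ := Nat.exists_eq_add_of_le hk
  rw [code_add, code_add] at h
  have := congrArg (fun w : FreeMonoid (Fin 3) => w.toList.take k) h
  have e : ∀ z : ℝ, (code ε l c z k).toList.length = k := fun z => length_code z k
  simpa [List.take_append, e, List.take_of_length_le] using this

theorem letter_eq_of_code_eq {x y : ℝ} {k n : ℕ} (h : code ε l c x n = code ε l c y n)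
    (hk : k < n) : letter ε l c ((T ε l c)^[k] x) = letter ε l c ((T ε l c)^[k] y) := by
  have h1 := code_eq_of_le h (Nat.succ_le_of_lt hk)
  have h2 := code_eq_of_le h hk.le
  rw [Nat.succ_eq_add_one, code_add, code_add, h2] at h1
  exact FreeMonoid.of_injective (mul_left_cancel h1)

theorem T_eq (x : ℝ) : T ε l c x = x + shift ε (letter ε l c x) := by
  unfold T letter shift
  split_ifs <;> simp <;> ring

theorem iterate_T_eq (x : ℝ) (n : ℕ) :
    (T ε l c)^[n] x = x + weight (shift ε) (code ε l c x n) := by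
  induction n generalizing x with
  | zero => simp
  | succ n ih =>
    rw [Function.iterate_succ_apply, ih, code_succ, weight_mul, weight_of, T_eq]; ring

theorem shift_injective (hp : 0 < ε) (h1 : ε < 1) :
    Function.Injective (shift ε) := by
  intro a b hab
  fin_cases a <;> fin_cases b <;> simp [shift] at hab ⊢ <;> linarith

/-! ### The map `T` -/

theorem letter_lt {x : ℝ} (h : x < c + l - 1 + ε) : letter ε l c x = 0 := by simp [letter, h]

theorem letter_mid {x : ℝ} (h : c + l - 1 + ε ≤ x) (h' : x < c + ε) : letter ε l c x = 1 := by
  simp [letter, h', not_lt.2 h]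

theorem IsExchange.letter_ge (h : IsExchange ε l c) {x : ℝ} (h' : c + ε ≤ x) :
    letter ε l c x = 2 := by
  have := h.l_lt
  have : ¬ x < c + l - 1 + ε := by linarith
  simp [letter, not_lt.2 h', this]

theorem IsExchange.T_mem (h : IsExchange ε l c) {x : ℝ} (hx : x ∈ Ico c (c + l)) :
    T ε l c x ∈ Ico c (c + l) := by
  obtain ⟨h1, h2, h3, h4, h5⟩ := h
  obtain ⟨hx1, hx2⟩ := hx
  unfold T
  split_ifs with a b <;> constructor <;> linarith

theorem IsExchange.iterate_mem (h : IsExchange ε l c) {x : ℝ} (hx : x ∈ Ico c (c + l)) (n : ℕ) :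
    (T ε l c)^[n] x ∈ Ico c (c + l) := by
  induction n with
  | zero => exact hx
  | succ n ih => rw [Function.iterate_succ_apply']; exact h.T_mem ih

theorem IsExchange.T_injOn (h : IsExchange ε l c) : InjOn (T ε l c) (Ico c (c + l)) := by
  obtain ⟨h1, h2, h3, h4, h5⟩ := h
  rintro x ⟨hx1, hx2⟩ y ⟨hy1, hy2⟩ e
  unfold T at e
  split_ifs at e <;> linarith

theorem IsExchange.iterate_injOn (h : IsExchange ε l c) (n : ℕ) :
    InjOn (T ε l c)^[n] (Ico c (c + l)) := by
  induction n with
  | zero => simp [InjOn]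
  | succ n ih =>
    intro x hx y hy e
    rw [Function.iterate_succ_apply, Function.iterate_succ_apply] at e
    exact h.T_injOn hx hy (ih (h.T_mem hx) (h.T_mem hy) e)

/-- `T` is induced on `[c, c + l)` by the rotation by `1 - ε` of a circle of length `1`. -/
theorem IsExchange.exists_iterate_eq (h : IsExchange ε l c) {x y : ℝ} (hx : x ∈ Ico c (c + l))
    (hy : y ∈ Ico c (c + l)) (k : ℕ) (m : ℤ) (e : y = x + (k * (1 - ε) - m)) :
    ∃ j ≤ k, (T ε l c)^[j] x = y := by
  induction k using Nat.strong_induction_on generalizing x m with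
  | _ k ih =>
  have hT := h.T_mem hx
  obtain ⟨h1, h2, h3, h4, h5⟩ := h
  rcases k with _ | k
  · refine ⟨0, le_rfl, ?_⟩
    have h6 : (m : ℝ) < 1 := by simp at e; linarith [hx.1, hx.2, hy.1, hy.2]
    have h7 : (-1 : ℝ) < m := by simp at e; linarith [hx.1, hx.2, hy.1, hy.2]
    have h6' : m < 1 := by exact_mod_cast h6
    have h7' : -1 < m := by exact_mod_cast h7
    have : m = 0 := by omega
    subst this
    simp at e ⊢
    exact e.symm
  by_cases a : x < c + l - 1 + ε
  · obtain ⟨j, hj, ej⟩ := ih k (by omega) hT m (by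
      rw [e]; simp [T, a]; ring)
    exact ⟨j + 1, by omega, by simpa using ej⟩
  by_cases b : x < c + ε
  · rcases k with _ | k
    · exfalso
      simp at e
      have h6 : (m : ℝ) < 1 := by linarith [hx.1, hx.2, hy.1, hy.2]
      have h7 : (0 : ℝ) < m := by linarith [hx.1, hx.2, hy.1, hy.2]
      have h6' : m < 1 := by exact_mod_cast h6
      have h7' : 0 < m := by exact_mod_cast h7
      omega
    obtain ⟨j, hj, ej⟩ := ih k (by omega) hT (m - 1) (by
      rw [e]; simp [T, a, b]; ring)
    exact ⟨j + 1, by omega, by simpa using ej⟩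
  · obtain ⟨j, hj, ej⟩ := ih k (by omega) hT (m - 1) (by
      rw [e]; simp [T, a, b]; ring)
    exact ⟨j + 1, by omega, by simpa using ej⟩

/-! ### Density of orbits -/

/-- The multiples of an irrational number are dense modulo `1`, with a uniform bound. -/
theorem exists_bound_add_mul_sub_mem_Ioo {α : ℝ} (hα : Irrational α) {p q : ℝ} (hpq : p < q) :
    ∃ K : ℕ, ∀ x : ℝ, ∃ k ≤ K, ∃ m : ℤ, x + (k * α - m) ∈ Ioo p q := by
  obtain ⟨n, hn⟩ := exists_nat_one_div_lt (sub_pos.2 hpq)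
  obtain ⟨j, k, hk0, -, hjk⟩ := Real.exists_int_int_abs_mul_sub_le α (Nat.succ_pos n)
  lift k to ℕ using hk0.le
  obtain ⟨δ, hδ⟩ : ∃ δ : ℝ, δ = α * k - j := ⟨_, rfl⟩
  have hδ0 : δ ≠ 0 := by
    rw [hδ, sub_ne_zero, mul_comm]
    exact (hα.natCast_mul (by exact_mod_cast hk0.ne')).ne_int j
  have hδ1 : |δ| < q - p := by
    rw [hδ, mul_comm]
    refine hjk.trans_lt (lt_trans ?_ hn)
    push_cast
    apply one_div_lt_one_div_of_lt <;> [positivity; linarith]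
  obtain ⟨N, hN⟩ := exists_nat_gt (1 / |δ|)
  have hNδ : 1 < N * |δ| := by
    rwa [div_lt_iff₀ (abs_pos.2 hδ0)] at hN
  refine ⟨N * k, fun x => ?_⟩
  rcases lt_or_gt_of_ne hδ0 with h | h
  · rw [abs_of_neg h] at hδ1 hNδ
    have hex : ∃ i : ℕ, x - (⌈x - q⌉ - 1) + i * δ < q := by
      refine ⟨N, ?_⟩
      have := Int.le_ceil (x - q)
      have := Int.ceil_lt_add_one (x - q)
      nlinarith
    classical
    set i := Nat.find hex with hi
    have h1 := Nat.find_spec hex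
    rw [← hi] at h1
    have hiN : i ≤ N := by
      apply Nat.find_min'
      have := Int.le_ceil (x - q)
      have := Int.ceil_lt_add_one (x - q)
      nlinarith
    have h2 : p < x - (⌈x - q⌉ - 1) + i * δ := by
      rcases Nat.eq_zero_or_pos i with h0 | h0
      · rw [h0] at h1
        have := Int.ceil_lt_add_one (x - q)
        simp at h1
        linarith
      · have := Nat.find_min hex (m := i - 1) (by omega)
        rw [Nat.cast_sub h0] at this
        push_cast at this
        nlinarith
    refine ⟨i * k, Nat.mul_le_mul_right _ hiN, i * j + (⌈x - q⌉ - 1), ?_⟩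
    have e : x + (((i * k : ℕ) : ℝ) * α - ((i * j + (⌈x - q⌉ - 1) : ℤ) : ℝ)) =
        x - (⌈x - q⌉ - 1) + i * δ := by rw [hδ]; push_cast; ring
    rw [e]; exact ⟨h2, h1⟩
  · rw [abs_of_pos h] at hδ1 hNδ
    have hex : ∃ i : ℕ, p < x - (⌊x - p⌋ + 1) + i * δ := by
      refine ⟨N, ?_⟩
      have := Int.floor_le (x - p)
      have := Int.lt_floor_add_one (x - p)
      nlinarith
    classical
    set i := Nat.find hex with hi
    have h1 := Nat.find_spec hex
    rw [← hi] at h1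
    have hiN : i ≤ N := by
      apply Nat.find_min'
      have := Int.floor_le (x - p)
      have := Int.lt_floor_add_one (x - p)
      nlinarith
    have h2 : x - (⌊x - p⌋ + 1) + i * δ < q := by
      rcases Nat.eq_zero_or_pos i with h0 | h0
      · rw [h0] at h1
        have := Int.lt_floor_add_one (x - p)
        simp at h1
        linarith
      · have := Nat.find_min hex (m := i - 1) (by omega)
        rw [Nat.cast_sub h0] at this
        push_cast at this
        nlinarith
    refine ⟨i * k, Nat.mul_le_mul_right _ hiN, i * j + (⌊x - p⌋ + 1), ?_⟩
    have e : x + (((i * k : ℕ) : ℝ) * α - ((i * j + (⌊x - p⌋ + 1) : ℤ) : ℝ)) =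
        x - (⌊x - p⌋ + 1) + i * δ := by rw [hδ]; push_cast; ring
    rw [e]; exact ⟨h1, h2⟩

theorem IsRegular.exists_bound_iterate_mem (h : IsRegular ε l c) {p q : ℝ} (hpq : p < q)
    (hp : c ≤ p) (hq : q ≤ c + l) :
    ∃ K : ℕ, ∀ x ∈ Ico c (c + l), ∃ k ≤ K, (T ε l c)^[k] x ∈ Ioo p q := by
  have h1 : Irrational (1 - ε) := by simpa using h.irr.ratCast_sub 1
  obtain ⟨K, hK⟩ := exists_bound_add_mul_sub_mem_Ioo h1 hpq
  refine ⟨K, fun x hx => ?_⟩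
  obtain ⟨k, hk, m, hm⟩ := hK x
  obtain ⟨j, hj, e⟩ := h.exists_iterate_eq hx
    (y := x + (k * (1 - ε) - m)) ⟨hp.trans hm.1.le, hm.2.trans_le hq⟩ k m rfl
  exact ⟨j, hj.trans hk, e ▸ hm⟩

theorem IsRegular.exists_iterate_mem (h : IsRegular ε l c) {p q : ℝ} (hpq : p < q)
    (hp : c ≤ p) (hq : q ≤ c + l) {x : ℝ} (hx : x ∈ Ico c (c + l)) :
    ∃ k, (T ε l c)^[k] x ∈ Ioo p q := by
  obtain ⟨K, hK⟩ := h.exists_bound_iterate_mem hpq hp hq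
  obtain ⟨k, -, hk⟩ := hK x hx
  exact ⟨k, hk⟩

/-- Backward orbits are dense. -/
theorem IsRegular.exists_iterate_eq_of_mem_Ioo (h : IsRegular ε l c) {p q : ℝ} (hpq : p < q)
    (hp : c ≤ p) (hq : q ≤ c + l) {y : ℝ} (hy : y ∈ Ico c (c + l)) :
    ∃ z ∈ Ioo p q, ∃ k, (T ε l c)^[k] z = y := by
  have h1 : Irrational (-(1 - ε)) := by simpa using (h.irr.ratCast_sub 1).neg
  obtain ⟨K, hK⟩ := exists_bound_add_mul_sub_mem_Ioo h1 hpq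
  obtain ⟨k, hk, m, hm⟩ := hK y
  obtain ⟨j, hj, e⟩ := h.exists_iterate_eq (x := y + (k * -(1 - ε) - m))
    ⟨hp.trans hm.1.le, hm.2.trans_le hq⟩ hy k (-m) (by push_cast; ring)
  exact ⟨_, hm, j, e⟩

theorem IsRegular.iterate_ne_self (h : IsRegular ε l c) (x : ℝ) {n : ℕ} (hn : n ≠ 0) :
    (T ε l c)^[n] x ≠ x := by
  rw [iterate_T_eq]
  have := weight_shift_ne_zero h.irr (w := code ε l c x n) (by simpa)
  simpa using this

theorem IsRegular.eq_of_iterate_eq (h : IsRegular ε l c) {x : ℝ} (hx : x ∈ Ico c (c + l))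
    {m n : ℕ} (e : (T ε l c)^[m] x = (T ε l c)^[n] x) : m = n := by
  wlog hmn : m ≤ n generalizing m n
  · exact (this e.symm (by omega)).symm
  obtain ⟨k, rfl⟩ := Nat.exists_eq_add_of_le hmn
  rw [Function.iterate_add_apply] at e
  have e' := h.iterate_injOn m hx (h.iterate_mem hx k) e
  by_contra hk
  exact h.iterate_ne_self x (n := k) (by omega) e'.symm

/-! ### Local constancy of the coding -/

theorem eventually_letter_eq_right (z : ℝ) :
    ∀ᶠ q in 𝓝[≥] z, letter ε l c q = letter ε l c z := by
  have key : ∀ d : ℝ, ∀ᶠ q in 𝓝[≥] z, (q < d ↔ z < d) := by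
    intro d
    rcases lt_or_ge z d with hz | hz
    · filter_upwards [mem_nhdsWithin_of_mem_nhds (Iio_mem_nhds hz)] with q hq
      exact ⟨fun _ => hz, fun _ => hq⟩
    · filter_upwards [self_mem_nhdsWithin] with q hq
      exact ⟨fun h => absurd (hz.trans hq) (not_le.2 h), fun h => absurd hz (not_le.2 h)⟩
  filter_upwards [key (c + l - 1 + ε), key (c + ε)] with q h1 h2
  simp only [letter, h1, h2]

theorem eventually_code_eq_right (z : ℝ) (n : ℕ) :
    ∀ᶠ q in 𝓝[≥] z, code ε l c q n = code ε l c z n := by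
  induction n generalizing z with
  | zero => simp
  | succ n ih =>
    have h1 : Tendsto (fun q => q + shift ε (letter ε l c z)) (𝓝[≥] z) (𝓝[≥] (T ε l c z)) := by
      apply tendsto_nhdsWithin_of_tendsto_nhds_of_eventually_within
      · rw [T_eq]
        exact ((continuous_id.add continuous_const).tendsto z).mono_left nhdsWithin_le_nhds
      · filter_upwards [self_mem_nhdsWithin] with q hq
        rw [mem_Ici, T_eq]
        simpa using hq
    filter_upwards [eventually_letter_eq_right z, h1.eventually (ih _)] with q hq hq'
    rw [code_succ, code_succ, hq, T_eq q, hq, hq']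

theorem eventually_letter_eq {z : ℝ} (h1 : z ≠ c + l - 1 + ε) (h2 : z ≠ c + ε) :
    ∀ᶠ q in 𝓝 z, letter ε l c q = letter ε l c z := by
  have key : ∀ d : ℝ, z ≠ d → ∀ᶠ q in 𝓝 z, (q < d ↔ z < d) := by
    intro d hd
    rcases lt_or_gt_of_ne hd with hz | hz
    · filter_upwards [Iio_mem_nhds hz] with q hq
      exact ⟨fun _ => hz, fun _ => hq⟩
    · filter_upwards [Ioi_mem_nhds hz] with q hq
      exact ⟨fun h => absurd (lt_trans hq h) (lt_irrefl _), fun h => absurd hz h.not_gt⟩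
  filter_upwards [key _ h1, key _ h2] with q h1 h2
  simp only [letter, h1, h2]

theorem eventually_code_eq {z : ℝ} {n : ℕ} (h1 : ∀ i < n, (T ε l c)^[i] z ≠ c + l - 1 + ε)
    (h2 : ∀ i < n, (T ε l c)^[i] z ≠ c + ε) :
    ∀ᶠ q in 𝓝 z, code ε l c q n = code ε l c z n := by
  induction n generalizing z with
  | zero => simp
  | succ n ih =>
    have ht : Tendsto (fun q => q + shift ε (letter ε l c z)) (𝓝 z) (𝓝 (T ε l c z)) := by
      rw [T_eq]
      exact (continuous_id.add continuous_const).tendsto z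
    have ih' := ih (z := T ε l c z) (fun i hi => h1 (i + 1) (by omega))
      (fun i hi => h2 (i + 1) (by omega))
    filter_upwards [eventually_letter_eq (h1 0 (by omega)) (h2 0 (by omega)),
      ht.eventually ih'] with q hq hq'
    rw [code_succ, code_succ, hq, T_eq q, hq, hq']

/-! ### Regularity from the i.d.o.c. -/

theorem irrational_of_infinite_orbit {x : ℝ} (hx : x ∈ Ico c (c + l)) (h : (orbit ε l c x).Infinite) :
    Irrational ε := by
  rintro ⟨r, rfl⟩
  apply h
  have hr : (r.den : ℝ) * r = r.num := by exact_mod_cast Rat.den_mul_eq_num r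
  have hd : (0 : ℝ) < r.den := by exact_mod_cast r.pos
  have key : ∀ w : FreeMonoid (Fin 3), ∃ m : ℤ, weight (shift (r : ℝ)) w = m / r.den := by
    intro w
    obtain ⟨k, m, -, e⟩ := exists_weight_shift (ε := (r : ℝ)) w
    refine ⟨k * (r.den - r.num) - m * r.den, ?_⟩
    rw [e, eq_div_iff hd.ne']
    push_cast
    rw [← hr]
    ring
  have key' : ∀ y ∈ orbit (r : ℝ) l c x, ∃ m : ℤ, y = x + m / r.den := by
    rintro y ⟨-, n, e | e⟩ <;> rw [iterate_T_eq] at e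
    · obtain ⟨m, hm⟩ := key (code (r : ℝ) l c x n)
      exact ⟨m, by rw [← hm, e]⟩
    · obtain ⟨m, hm⟩ := key (code (r : ℝ) l c y n)
      refine ⟨-m, ?_⟩
      rw [hm] at e
      rw [← e]; push_cast; ring
  refine ((finite_Icc (-⌈l * r.den⌉) ⌈l * r.den⌉).image fun m : ℤ => x + m / r.den).subset ?_
  intro y hy
  obtain ⟨m, hm⟩ := key' y hy
  refine ⟨m, ?_, hm.symm⟩
  have hyI := hy.1
  have h1 : (m : ℝ) = (y - x) * r.den := by rw [hm]; field_simp; ring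
  have h2 := Int.le_ceil (l * r.den)
  constructor
  · have : (-⌈l * r.den⌉ : ℝ) ≤ m := by rw [h1]; nlinarith [hyI.1, hyI.2, hx.1, hx.2]
    exact_mod_cast this
  · have : (m : ℝ) ≤ ⌈l * r.den⌉ := by rw [h1]; nlinarith [hyI.1, hyI.2, hx.1, hx.2]
    exact_mod_cast this

theorem IsExchange.isRegular (h : IsExchange ε l c) (hi : IDOC ε l c) : IsRegular ε l c := by
  have h1 : c + l - 1 + ε ∈ Ico c (c + l) := by
    constructor <;> linarith [h.one_sub_lt, h.lt_one]
  have h2 : c + ε ∈ Ico c (c + l) := by constructor <;> linarith [h.lt_l, h.pos]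
  refine ⟨h, irrational_of_infinite_orbit h2 hi.2.1, fun n e => ?_, fun n e => ?_⟩
  · exact hi.2.2.le_bot (show c + ε ∈ _ from ⟨⟨h2, n, .inl e⟩, h2, 0, .inl rfl⟩)
  · exact hi.2.2.le_bot (show c + l - 1 + ε ∈ _ from ⟨⟨h1, 0, .inl rfl⟩, h1, n, .inl e⟩)

/-! ### Substitutions that scale the coding -/

/-- The coding of the orbit of `ν * y` is the image under `φ` of the coding of the orbit of `y`, and
`φ` multiplies all translations by `ν`. -/
structure IsScaling (ε l c : ℝ) (φ : Substitution (Fin 3)) (ν : ℝ) : Prop where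
  mul_mem : ∀ y ∈ Ico c (c + l), ν * y ∈ Ico c (c + l)
  code_eq : ∀ y ∈ Ico c (c + l), code ε l c (ν * y) (φ (FreeMonoid.of (letter ε l c y))).length =
    φ (FreeMonoid.of (letter ε l c y))
  weight_eq : ∀ a, weight (shift ε) (φ (FreeMonoid.of a)) = ν * shift ε a

namespace IsScaling

variable {φ : Substitution (Fin 3)} {ν : ℝ}

theorem weight_map (h : IsScaling ε l c φ ν) (w : FreeMonoid (Fin 3)) :
    weight (shift ε) (φ w) = ν * weight (shift ε) w := by
  rw [ThreeIet.weight_map]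
  simp only [h.weight_eq, weight_smul]

theorem iterate_letter (h : IsScaling ε l c φ ν) {y : ℝ} (hy : y ∈ Ico c (c + l)) :
    (T ε l c)^[(φ (FreeMonoid.of (letter ε l c y))).length] (ν * y) = ν * T ε l c y := by
  rw [iterate_T_eq, h.code_eq y hy, h.weight_eq, T_eq]; ring

theorem code_map (he : IsExchange ε l c) (h : IsScaling ε l c φ ν) {y : ℝ}
    (hy : y ∈ Ico c (c + l)) (n : ℕ) :
    code ε l c (ν * y) (φ (code ε l c y n)).length = φ (code ε l c y n) := by
  induction n generalizing y with
  | zero => simp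
  | succ n ih =>
    rw [code_succ, map_mul, FreeMonoid.length_mul, code_add, h.code_eq y hy, h.iterate_letter hy,
      ih (he.T_mem hy)]

theorem iterate_map (he : IsExchange ε l c) (h : IsScaling ε l c φ ν) {y : ℝ}
    (hy : y ∈ Ico c (c + l)) (n : ℕ) :
    (T ε l c)^[(φ (code ε l c y n)).length] (ν * y) = ν * (T ε l c)^[n] y := by
  rw [iterate_T_eq, h.code_map he hy, h.weight_map, iterate_T_eq]; ring

theorem pow_mul_mem (h : IsScaling ε l c φ ν) {y : ℝ} (hy : y ∈ Ico c (c + l)) (k : ℕ) :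
    ν ^ k * y ∈ Ico c (c + l) := by
  induction k with
  | zero => simpa
  | succ k ih => rw [pow_succ', mul_assoc]; exact h.mul_mem _ ih

theorem code_iterate (he : IsExchange ε l c) (h : IsScaling ε l c φ ν) {y : ℝ}
    (hy : y ∈ Ico c (c + l)) (n k : ℕ) :
    code ε l c (ν ^ k * y) (φ^[k] (code ε l c y n)).length = φ^[k] (code ε l c y n) := by
  induction k with
  | zero => simp
  | succ k ih =>
    rw [Function.iterate_succ_apply', pow_succ', mul_assoc, ← ih]
    exact h.code_map he (h.pow_mul_mem hy k) _

theorem weight_iterate (h : IsScaling ε l c φ ν) (w : FreeMonoid (Fin 3)) (k : ℕ) :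
    weight (shift ε) (φ^[k] w) = ν ^ k * weight (shift ε) w := by
  induction k with
  | zero => simp
  | succ k ih => rw [Function.iterate_succ_apply', h.weight_map, ih]; ring

theorem length_ne_zero (hr : IsRegular ε l c) (h : IsScaling ε l c φ ν) (hν : ν ≠ 0) (a : Fin 3) :
    (φ (FreeMonoid.of a)).length ≠ 0 := by
  intro h0
  have h1 := h.weight_eq a
  rw [FreeMonoid.length_eq_zero.1 h0, weight_one] at h1
  have h2 := weight_shift_ne_zero hr.irr (w := FreeMonoid.of a) (by simp)
  rw [weight_of] at h2
  exact mul_ne_zero hν h2 h1.symm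

theorem length_le (hr : IsRegular ε l c) (h : IsScaling ε l c φ ν) (hν : ν ≠ 0)
    (w : FreeMonoid (Fin 3)) : w.length ≤ (φ w).length := by
  induction w using FreeMonoid.inductionOn' with
  | one => simp
  | of_mul a w ih =>
    have := h.length_ne_zero hr hν a
    rw [map_mul, FreeMonoid.length_mul, FreeMonoid.length_mul, FreeMonoid.length_of]
    omega

end IsScaling

/-- Every letter has a representative point. -/
theorem IsExchange.exists_letter_eq (he : IsExchange ε l c) (a : Fin 3) :
    ∃ y ∈ Ico c (c + l), letter ε l c y = a := by
  obtain ⟨h1, h2, h3, h4, h5⟩ := id he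
  fin_cases a
  · exact ⟨c, ⟨le_rfl, by linarith⟩, letter_lt (by linarith)⟩
  · exact ⟨c + l - 1 + ε, ⟨by linarith, by linarith⟩, letter_mid le_rfl (by linarith)⟩
  · exact ⟨c + ε, ⟨by linarith, by linarith⟩, he.letter_ge le_rfl⟩

theorem mem_code_iff {x : ℝ} {n : ℕ} {a : Fin 3} :
    a ∈ (code ε l c x n).toList ↔ ∃ i < n, letter ε l c ((T ε l c)^[i] x) = a := by
  simp [code]

/-- All letters occur in all sufficiently long factors. -/
theorem IsRegular.exists_bound_mem_code (hr : IsRegular ε l c) :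
    ∃ K : ℕ, ∀ x ∈ Ico c (c + l), ∀ n ≥ K, ∀ a, a ∈ (code ε l c x n).toList := by
  obtain ⟨h1, h2, h3, h4, h5⟩ := hr.toIsExchange
  obtain ⟨K₀, h₀⟩ := hr.exists_bound_iterate_mem (p := c) (q := c + l - 1 + ε) (by linarith)
    le_rfl (by linarith)
  obtain ⟨K₁, h₁⟩ := hr.exists_bound_iterate_mem (p := c + l - 1 + ε) (q := c + ε) (by linarith)
    (by linarith) (by linarith)
  obtain ⟨K₂, h₂⟩ := hr.exists_bound_iterate_mem (p := c + ε) (q := c + l) (by linarith)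
    (by linarith) le_rfl
  refine ⟨K₀ + K₁ + K₂ + 1, fun x hx n hn a => ?_⟩
  rw [mem_code_iff]
  fin_cases a
  · obtain ⟨k, hk, m⟩ := h₀ x hx
    exact ⟨k, by omega, letter_lt m.2⟩
  · obtain ⟨k, hk, m⟩ := h₁ x hx
    exact ⟨k, by omega, letter_mid m.1.le m.2⟩
  · obtain ⟨k, hk, m⟩ := h₂ x hx
    exact ⟨k, by omega, hr.letter_ge m.1.le⟩

/-- The nonempty words of bounded length have displacements bounded away from `0`. -/
theorem exists_pos_le_abs_weight_shift (h : Irrational ε) (K : ℕ) :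
    ∃ η > 0, ∀ w : FreeMonoid (Fin 3), w.length ≠ 0 → w.length ≤ K →
      η ≤ |weight (shift ε) w| := by
  have hfin : {w : FreeMonoid (Fin 3) | w.length ≠ 0 ∧ w.length ≤ K}.Finite :=
    (List.finite_length_le (Fin 3) K).subset fun w hw => hw.2
  obtain ⟨s, hs⟩ := hfin.exists_finset_coe
  have hmem : ∀ w, w ∈ s ↔ w.length ≠ 0 ∧ w.length ≤ K := fun w => by
    rw [← Finset.mem_coe, hs]; rfl
  rcases s.eq_empty_or_nonempty with h0 | h0
  · exact ⟨1, one_pos, fun w h1 h2 => by simpa [h0] using (hmem w).2 ⟨h1, h2⟩⟩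
  obtain ⟨w₀, hw₀, hmin⟩ := s.exists_min_image (fun w => |weight (shift ε) w|) h0
  exact ⟨_, abs_pos.2 (weight_shift_ne_zero h ((hmem _).1 hw₀).1),
    fun w h1 h2 => hmin w ((hmem w).2 ⟨h1, h2⟩)⟩

theorem IsScaling.isPrimitive (hr : IsRegular ε l c) {φ : Substitution (Fin 3)} {ν : ℝ}
    (h : IsScaling ε l c φ ν) (hν : ν ≠ 0) (hν1 : |ν| < 1) : IsPrimitive φ := by
  obtain ⟨K, hK⟩ := hr.exists_bound_mem_code
  obtain ⟨η, hη, hw⟩ := exists_pos_le_abs_weight_shift hr.irr K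
  have ht : Tendsto (fun n : ℕ => |ν| ^ n) atTop (𝓝 0) :=
    tendsto_pow_atTop_nhds_zero_of_lt_one (abs_nonneg _) hν1
  obtain ⟨n, hn⟩ := (ht.eventually (gt_mem_nhds hη)).exists
  refine ⟨n, fun a b => ?_⟩
  obtain ⟨y, hy, rfl⟩ := hr.exists_letter_eq a
  rw [← code_one, ← h.code_iterate hr.toIsExchange hy 1 n]
  apply hK _ (h.pow_mul_mem hy n)
  by_contra hlt
  have hs : |shift ε (letter ε l c y)| ≤ 1 := by
    obtain ⟨h1, h2, h3, h4, h5⟩ := hr.toIsExchange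
    rw [abs_le]
    generalize letter ε l c y = a
    fin_cases a <;> simp [shift] <;> constructor <;> linarith
  have hwe := h.weight_iterate (code ε l c y 1) n
  have h0 : (φ^[n] (code ε l c y 1)).length ≠ 0 := by
    intro h0
    rw [FreeMonoid.length_eq_zero.1 h0, weight_one, code_one, weight_of] at hwe
    have := weight_shift_ne_zero hr.irr (w := FreeMonoid.of (letter ε l c y)) (by simp)
    rw [weight_of] at this
    exact mul_ne_zero (pow_ne_zero n hν) this hwe.symm
  have h1 := hw _ h0 (by omega)
  rw [hwe, code_one, weight_of, abs_mul, abs_pow] at h1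
  have : |ν| ^ n * |shift ε (letter ε l c y)| ≤ |ν| ^ n * 1 := by gcongr
  linarith

theorem iterate_eq_add {x : ℤ → ℝ} (hT : ∀ n, x (n + 1) = T ε l c (x n)) (i : ℤ) (k : ℕ) :
    (T ε l c)^[k] (x i) = x (i + k) := by
  induction k with
  | zero => simp
  | succ k ih => rw [Function.iterate_succ_apply', ih, ← hT]; push_cast; ring_nf

theorem factor_eq_code {u : ℤ → Fin 3} {x : ℤ → ℝ} (hT : ∀ n, x (n + 1) = T ε l c (x n))
    (hu : ∀ n, u n = letter ε l c (x n)) (i : ℤ) (n : ℕ) :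
    factor u i n = code ε l c (x i) n := by
  unfold factor code
  congr 1
  have e : (do let a ← List.range n; pure (a : ℤ)) =
      List.map (fun a : ℕ => (a : ℤ)) (List.range n) :=
    List.flatMap_pure_eq_map _ _
  rw [e, List.map_map]
  exact List.map_congr_left fun k _ => by rw [Function.comp_apply, hu, iterate_eq_add hT]

theorem IsScaling.isInvariant (hr : IsRegular ε l c) {φ : Substitution (Fin 3)} {ν : ℝ}
    (h : IsScaling ε l c φ ν) (hν : ν ≠ 0) {u : ℤ → Fin 3} (hu : IsCoding ε l c u) :
    IsInvariant φ u := by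
  obtain ⟨x, hx0, hxI, hT, hu⟩ := hu
  have hf := factor_eq_code hT hu
  have he := hr.toIsExchange
  refine ⟨fun N => ⟨N, ?_⟩, fun N => ⟨N, ?_⟩, fun m => ?_, fun m => ?_⟩
  · simpa [hf] using h.length_le hr hν (factor u 0 N)
  · simpa [hf] using h.length_le hr hν (factor u (-(N : ℤ)) N)
  · have := h.code_map he (hxI 0) m
    rw [hx0, mul_zero] at this
    rw [hf, hf, hx0, this]
  · have h1 := h.code_map he (hxI (-m)) m
    have h2 := h.iterate_map he (hxI (-m)) m
    rw [hf, hf]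
    set L := (φ (code ε l c (x (-m)) m)).length
    have h3 := iterate_eq_add hT (-m) m
    have h4 := iterate_eq_add hT (-L) L
    rw [neg_add_cancel, hx0] at h3 h4
    rw [h3, mul_zero, ← h4] at h2
    rw [← he.iterate_injOn L (h.mul_mem _ (hxI _)) (hxI _) h2, h1]

/-! ### From an interval to a substitution -/

theorem toList_code_returnTime (J : Set ℝ) (z : ℝ) :
    (code ε l c z (returnTime ε l c J z)).toList = returnName ε l c J z := rfl

theorem exists_isScaling_of_interval (hr : IsRegular ε l c) {J : Set ℝ} (hJ : J ⊆ Ico c (c + l))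
    (h1 : P1 ε l c J) (h2 : P2 ε l c J) :
    ∃ φ ν, ν ≠ 0 ∧ |ν| < 1 ∧ IsScaling ε l c φ ν := by
  obtain ⟨ν, hν1, hν0, hJe, hT⟩ := h1
  have hmem : ∀ y ∈ Ico c (c + l), ν * y ∈ J := fun y hy => hJe ▸ mem_image_of_mem _ hy
  have hret : ∀ y ∈ Ico c (c + l), firstReturn ε l c J (ν * y) = ν * T ε l c y := fun y hy => by
    rw [hT _ (hmem y hy), mul_div_cancel_left₀ _ hν0]
  set name : ℝ → FreeMonoid (Fin 3) := fun y => code ε l c (ν * y) (returnTime ε l c J (ν * y))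
    with hname
  have hweight : ∀ y ∈ Ico c (c + l), weight (shift ε) (name y) = ν * shift ε (letter ε l c y) := by
    intro y hy
    have := hret y hy
    rw [firstReturn, iterate_T_eq, T_eq] at this
    simp only [hname]
    linarith
  choose p hp hpl using hr.exists_letter_eq
  have hinj : Function.Injective fun a => (name (p a)).toList := by
    intro a b hab
    have hab' : name (p a) = name (p b) := hab
    have h3 := hweight _ (hp a)
    rw [hab', hweight _ (hp b), hpl, hpl] at h3
    exact (shift_injective hr.pos hr.lt_one (mul_left_cancel₀ hν0 h3)).symm
  have hset : range (fun a => (name (p a)).toList) = returnName ε l c J '' J := by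
    apply eq_of_subset_of_ncard_le
    · rintro _ ⟨a, rfl⟩
      exact ⟨_, hmem _ (hp a), rfl⟩
    · rw [ncard_range_of_injective hinj, h2]; simp
    · exact finite_of_ncard_ne_zero (by rw [h2]; simp)
  have hn : ∀ y ∈ Ico c (c + l), name (p (letter ε l c y)) = name y := by
    intro y hy
    have : returnName ε l c J (ν * y) ∈ range fun a => (name (p a)).toList :=
      hset ▸ mem_image_of_mem _ (hmem y hy)
    obtain ⟨a, ha⟩ := this
    have ha' : name (p a) = name y := ha
    have h3 := hweight _ (hp a)
    rw [ha', hweight _ hy, hpl] at h3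
    rw [shift_injective hr.pos hr.lt_one (mul_left_cancel₀ hν0 h3), ha']
  refine ⟨FreeMonoid.lift fun a => name (p a), ν, hν0, abs_lt.2 hν1,
    fun y hy => hJ (hmem y hy), fun y hy => ?_, fun a => ?_⟩
  · rw [FreeMonoid.lift_eval_of, hn y hy]
    simp [hname]
  · rw [FreeMonoid.lift_eval_of, hweight _ (hp a), hpl]

theorem exists_substitution_of_interval (hr : IsRegular ε l c) {u : ℤ → Fin 3}
    (hu : IsCoding ε l c u) {J : Set ℝ} (hJ : J ⊆ Ico c (c + l)) (h1 : P1 ε l c J)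
    (h2 : P2 ε l c J) : ∃ φ : Substitution (Fin 3), IsPrimitive φ ∧ IsInvariant φ u := by
  obtain ⟨φ, ν, hν0, hν1, h⟩ := exists_isScaling_of_interval hr hJ h1 h2
  exact ⟨φ, h.isPrimitive hr hν0 hν1, h.isInvariant hr hν0 hu⟩

/-! ### Weights with bounded sums along an orbit -/

theorem weight_code_add (τ : Fin 3 → ℝ) (x : ℝ) (m n : ℕ) :
    weight τ (code ε l c x (m + n)) =
      weight τ (code ε l c x m) + weight τ (code ε l c ((T ε l c)^[m] x) n) := by
  rw [code_add, weight_mul]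

/-- If the sums of `τ` along an orbit are bounded, then they vary little at the visits of the orbit
to a suitable interval. -/
theorem IsRegular.exists_Ioo_abs_weight_sub_le (hr : IsRegular ε l c) {x : ℝ}
    (hx : x ∈ Ico c (c + l)) {τ : Fin 3 → ℝ} {C : ℝ}
    (hC : ∀ n, |weight τ (code ε l c x n)| ≤ C) {δ : ℝ} (hδ : 0 < δ) :
    ∃ p q, p < q ∧ c ≤ p ∧ q ≤ c + l ∧ ∀ m n, (T ε l c)^[m] x ∈ Ioo p q →
      (T ε l c)^[n] x ∈ Ioo p q →
      |weight τ (code ε l c x m) - weight τ (code ε l c x n)| ≤ δ := by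
  set H : ℕ → ℝ := fun n => weight τ (code ε l c x n) with hH
  have hba : BddAbove (range H) := ⟨C, by rintro _ ⟨n, rfl⟩; exact (abs_le.1 (hC n)).2⟩
  have hbb : BddBelow (range H) := ⟨-C, by rintro _ ⟨n, rfl⟩; exact (abs_le.1 (hC n)).1⟩
  obtain ⟨_, ⟨n₁, rfl⟩, h₁⟩ := exists_lt_of_lt_csSup (range_nonempty H)
    (show sSup (range H) - δ / 2 < _ by linarith)
  obtain ⟨_, ⟨n₀, rfl⟩, h₀⟩ := exists_lt_of_csInf_lt (range_nonempty H)
    (show _ < sInf (range H) + δ / 2 by linarith)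
  have hs : ∀ n, H n ≤ sSup (range H) := fun n => le_csSup hba ⟨n, rfl⟩
  have hi : ∀ n, sInf (range H) ≤ H n := fun n => csInf_le hbb ⟨n, rfl⟩
  have key : ∀ a k : ℕ, ∃ p q, p < q ∧ c ≤ p ∧ q ≤ c + l ∧ ∀ n, (T ε l c)^[n] x ∈ Ioo p q →
      H (n + k) - H n = H (a + k) - H a := by
    intro a k
    have hz := hr.iterate_mem hx a
    obtain ⟨u, hu, hsub⟩ := mem_nhdsGE_iff_exists_Ico_subset.1
      (eventually_code_eq_right (ε := ε) (l := l) (c := c) ((T ε l c)^[a] x) k)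
    refine ⟨_, min u (c + l), lt_min hu hz.2, hz.1, min_le_right _ _, fun n hn => ?_⟩
    have : code ε l c ((T ε l c)^[n] x) k = code ε l c ((T ε l c)^[a] x) k :=
      hsub ⟨hn.1.le, hn.2.trans_le (min_le_left _ _)⟩
    simp only [hH, weight_code_add, this]
    ring
  rcases le_total n₀ n₁ with hle | hle
  · obtain ⟨k, rfl⟩ := Nat.exists_eq_add_of_le hle
    obtain ⟨p, q, hpq, hp, hq, h⟩ := key n₀ k
    refine ⟨p, q, hpq, hp, hq, fun m n hm hn => ?_⟩
    have e1 := h m hm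
    have e2 := h n hn
    rw [abs_le]
    constructor <;> linarith [hs (m + k), hs (n + k), hi m, hi n]
  · obtain ⟨k, rfl⟩ := Nat.exists_eq_add_of_le hle
    obtain ⟨p, q, hpq, hp, hq, h⟩ := key n₁ k
    refine ⟨p, q, hpq, hp, hq, fun m n hm hn => ?_⟩
    have e1 := h m hm
    have e2 := h n hn
    rw [abs_le]
    constructor <;> linarith [hi (m + k), hi (n + k), hs m, hs n]

/-- The orbits on the two sides of the left discontinuity are asymptotic in both directions; they
differ by a factor `13` against a factor `2`. -/
theorem IsRegular.weight_mid_eq (hr : IsRegular ε l c) {x : ℝ}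
    (hx : x ∈ Ico c (c + l)) {τ : Fin 3 → ℝ} {C : ℝ}
    (hC : ∀ n, |weight τ (code ε l c x n)| ≤ C) : τ 1 = τ 0 + τ 2 := by
  by_contra hne
  have hne' : τ 0 + τ 2 - τ 1 ≠ 0 := fun h => hne (by linarith)
  obtain ⟨g1, g2, g3, g4, g5⟩ := hr.toIsExchange
  obtain ⟨p, q, hpq, hp, hq, hosc⟩ := hr.exists_Ioo_abs_weight_sub_le hx hC
    (δ := |τ 0 + τ 2 - τ 1| / 3) (by positivity)
  obtain ⟨z, hz, i, hi⟩ := hr.exists_iterate_eq_of_mem_Ioo hpq hp hq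
    (y := c + l - 1 + ε) ⟨by linarith, by linarith⟩
  set e := c + l - ε with he
  have heT : T ε l c (c + l - 1 + ε) = e := by
    have : c + l - 1 + ε < c + ε := by linarith
    simp only [T, lt_irrefl, if_false, this, if_true, he]; ring
  obtain ⟨j, hj⟩ := hr.exists_iterate_mem hpq hp hq (x := e) ⟨by linarith, by linarith⟩
  have ev1 : ∀ᶠ r in 𝓝 z, code ε l c r i = code ε l c z i := by
    apply eventually_code_eq
    · intro k hk e1
      have e2 : (T ε l c)^[i - k] ((T ε l c)^[k] z) = (T ε l c)^[i] z := by
        rw [← Function.iterate_add_apply, Nat.sub_add_cancel hk.le]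
      rw [hi, e1] at e2
      exact hr.iterate_ne_self _ (by omega) e2
    · intro k hk e1
      have e2 : (T ε l c)^[i - k] ((T ε l c)^[k] z) = (T ε l c)^[i] z := by
        rw [← Function.iterate_add_apply, Nat.sub_add_cancel hk.le]
      rw [hi, e1] at e2
      exact hr.iterate_right_ne _ e2
  have ev2 : ∀ᶠ r in 𝓝 e, code ε l c r j = code ε l c e j := by
    apply eventually_code_eq
    · intro k _ e1
      rw [← heT, ← Function.iterate_succ_apply] at e1
      exact hr.iterate_ne_self _ (by omega) e1
    · intro k _ e1
      rw [← heT, ← Function.iterate_succ_apply] at e1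
      exact hr.iterate_left_ne _ e1
  have hadd : ∀ y : ℝ, Tendsto (fun s : ℝ => y + s) (𝓝 0) (𝓝 y) := fun y => by
    have hcont : Continuous fun s : ℝ => y + s := by fun_prop
    simpa using hcont.tendsto 0
  have hpos : 0 < min (1 - l) (l - ε) := lt_min (by linarith) (by linarith)
  obtain ⟨η, hη, hev⟩ := Metric.eventually_nhds_iff.1 ((((hadd z).eventually ev1).and
    ((hadd e).eventually ev2)).and
    (((hadd _).eventually (isOpen_Ioo.mem_nhds hj)).and (Metric.ball_mem_nhds (0 : ℝ) hpos)))
  simp only [dist_zero_right, Real.norm_eq_abs, lt_min_iff] at hev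
  have hin : ∀ n s, (T ε l c)^[n] x = z + s → |s| < η →
      (T ε l c)^[n + i] x = c + l - 1 + ε + s ∧
      weight τ (code ε l c x (n + i)) = weight τ (code ε l c x n) + weight τ (code ε l c z i) := by
    intro n s hn hs
    constructor
    · rw [add_comm, Function.iterate_add_apply, hn, iterate_T_eq, (hev hs).1.1, ← hi,
        iterate_T_eq z]
      ring
    · rw [weight_code_add, hn, (hev hs).1.1]
  have hout : ∀ n s, (T ε l c)^[n] x = e + s → |s| < η →
      (T ε l c)^[n + j] x ∈ Ioo p q ∧
      weight τ (code ε l c x (n + j)) = weight τ (code ε l c x n) + weight τ (code ε l c e j) := by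
    intro n s hn hs
    constructor
    · have := (hev hs).2.1
      rw [iterate_T_eq] at this
      rw [add_comm, Function.iterate_add_apply, hn, iterate_T_eq, (hev hs).1.2]
      rw [add_right_comm]
      exact this
    · rw [weight_code_add, hn, (hev hs).1.2]
  have hstep : ∀ n, (T ε l c)^[n + 1] x = T ε l c ((T ε l c)^[n] x) ∧
      weight τ (code ε l c x (n + 1)) =
        weight τ (code ε l c x n) + τ (letter ε l c ((T ε l c)^[n] x)) := fun n =>
    ⟨Function.iterate_succ_apply' _ _ _, by rw [weight_code_add, code_one, weight_of]⟩
  obtain ⟨n, hn⟩ := hr.exists_iterate_mem (p := max p (z - η)) (q := z)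
    (max_lt hz.1 (by linarith)) (hp.trans (le_max_left _ _)) (hz.2.le.trans hq) hx
  obtain ⟨m, hm⟩ := hr.exists_iterate_mem (p := z) (q := min q (z + η))
    (lt_min hz.2 (by linarith)) (hp.trans hz.1.le) ((min_le_left _ _).trans hq) hx
  obtain ⟨s, hs⟩ : ∃ s, s = (T ε l c)^[n] x - z := ⟨_, rfl⟩
  obtain ⟨r, hr'⟩ : ∃ r, r = (T ε l c)^[m] x - z := ⟨_, rfl⟩
  have hn1 := max_lt_iff.1 hn.1
  have hm1 := lt_min_iff.1 hm.2
  have hs0 : s < 0 := by linarith [hn.2]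
  have hr0 : 0 < r := by linarith [hm.1]
  have hsη : |s| < η := by rw [abs_of_neg hs0]; linarith
  have hrη : |r| < η := by rw [abs_of_pos hr0]; linarith
  have hs2 := (hev hsη).2.2
  have hr2 := (hev hrη).2.2
  rw [abs_of_neg hs0] at hs2
  rw [abs_of_pos hr0] at hr2
  obtain ⟨a1, a2⟩ := hin n s (by linarith) hsη
  obtain ⟨b1, b2⟩ := hin m r (by linarith) hrη
  obtain ⟨a3, a4⟩ := hstep (n + i)
  rw [a1, letter_lt (by linarith)] at a4
  rw [a1, T_eq, letter_lt (by linarith)] at a3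
  have a3' : (T ε l c)^[n + i + 1] x = c + l + s := by rw [a3]; simp [shift]; ring
  obtain ⟨a5, a6⟩ := hstep (n + i + 1)
  rw [a3', hr.letter_ge (by linarith)] at a6
  rw [a3', T_eq, hr.letter_ge (by linarith)] at a5
  have a5' : (T ε l c)^[n + i + 1 + 1] x = e + s := by rw [a5]; simp [shift, he]; ring
  obtain ⟨b3, b4⟩ := hstep (m + i)
  rw [b1, letter_mid (by linarith) (by linarith)] at b4
  rw [b1, T_eq, letter_mid (by linarith) (by linarith)] at b3
  have b3' : (T ε l c)^[m + i + 1] x = e + r := by rw [b3]; simp [shift, he]; ring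
  obtain ⟨a7, a8⟩ := hout _ s a5' hsη
  obtain ⟨b7, b8⟩ := hout _ r b3' hrη
  have o1 := abs_le.1 (hosc n m ⟨hn1.1, hn.2.trans hz.2⟩ ⟨hz.1.trans hm.1, hm1.1⟩)
  have o2 := abs_le.1 (hosc _ _ a7 b7)
  have hP : |τ 0 + τ 2 - τ 1| ≤ 2 * (|τ 0 + τ 2 - τ 1| / 3) := by
    rw [abs_le]
    constructor <;> linarith [o1.1, o1.2, o2.1, o2.2]
  linarith [abs_pos.2 hne']

/-- Weights with bounded sums along an orbit are multiples of the translations. -/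
theorem IsRegular.exists_eq_mul_shift (hr : IsRegular ε l c) {x : ℝ}
    (hx : x ∈ Ico c (c + l)) {τ : Fin 3 → ℝ} {C : ℝ}
    (hC : ∀ n, |weight τ (code ε l c x n)| ≤ C) : ∃ ν, ∀ a, τ a = ν * shift ε a := by
  obtain ⟨g1, g2, g3, g4, g5⟩ := hr.toIsExchange
  have hmid := hr.weight_mid_eq hx hC
  set κ := τ 0 * ε + τ 2 * (1 - ε) with hκ
  have hlen : ∀ w : FreeMonoid (Fin 3), ∃ r : ℝ, (w.length : ℝ) ≤ r ∧
      κ * r = weight τ w + (τ 2 - τ 0) * weight (shift ε) w := by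
    intro w
    induction w using FreeMonoid.inductionOn' with
    | one => exact ⟨0, by simp⟩
    | of_mul a w ih =>
      obtain ⟨r, h1, h2⟩ := ih
      simp only [weight_mul, weight_of, FreeMonoid.length_mul, FreeMonoid.length_of]
      fin_cases a
      · refine ⟨r + 1, by push_cast; linarith, ?_⟩
        rw [mul_add, h2]; simp [shift, hκ]; ring
      · refine ⟨r + 2, by push_cast; linarith, ?_⟩
        rw [mul_add, h2]; simp [shift, hκ, hmid]; ring
      · refine ⟨r + 1, by push_cast; linarith, ?_⟩
        rw [mul_add, h2]; simp [shift, hκ]; ring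
  have hκ0 : κ = 0 := by
    by_contra h0
    have hpos := abs_pos.2 h0
    obtain ⟨n, hn⟩ := exists_nat_gt ((C + |τ 2 - τ 0|) / |κ|)
    rw [div_lt_iff₀ hpos] at hn
    obtain ⟨r, h1, h2⟩ := hlen (code ε l c x n)
    rw [length_code] at h1
    have hr0 : 0 ≤ r := le_trans (by positivity) h1
    have hw : |weight (shift ε) (code ε l c x n)| ≤ 1 := by
      have h3 := hr.iterate_mem hx n
      rw [iterate_T_eq] at h3
      rw [abs_le]
      constructor <;> linarith [h3.1, h3.2, hx.1, hx.2]
    have h4 : |κ| * r ≤ C + |τ 2 - τ 0| := by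
      calc |κ| * r = |κ * r| := by rw [abs_mul, abs_of_nonneg hr0]
        _ ≤ |weight τ (code ε l c x n)| + |τ 2 - τ 0| * |weight (shift ε) (code ε l c x n)| := by
          rw [h2, ← abs_mul]; exact abs_add_le _ _
        _ ≤ C + |τ 2 - τ 0| * 1 := by gcongr; exact hC n
        _ = _ := by rw [mul_one]
    nlinarith
  have h1ε : 1 - ε ≠ 0 := by linarith
  refine ⟨τ 0 / (1 - ε), fun a => ?_⟩
  fin_cases a
  · simp [shift]; field_simp
  · simp [shift]; rw [hmid]; field_simp; linarith
  · simp [shift]; field_simp; linarith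

/-! ### From an invariant word to a scaling substitution -/

/-- `φ` fixes the right half of the coding of `0`. -/
def FixesCode (ε l c : ℝ) (φ : Substitution (Fin 3)) : Prop :=
  ∀ m, φ (code ε l c 0 m) = code ε l c 0 (φ (code ε l c 0 m)).length

theorem IsInvariant.fixesCode {φ : Substitution (Fin 3)} {u : ℤ → Fin 3} (h : IsInvariant φ u)
    (hu : IsCoding ε l c u) : FixesCode ε l c φ := by
  obtain ⟨x, hx0, hxI, hT, hu⟩ := hu
  intro m
  have := h.2.2.1 m
  rwa [factor_eq_code hT hu, factor_eq_code hT hu, hx0] at this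

theorem FixesCode.comp {φ ψ : Substitution (Fin 3)} (hφ : FixesCode ε l c φ)
    (hψ : FixesCode ε l c ψ) : FixesCode ε l c (ψ.comp φ) := by
  intro m
  simp only [MonoidHom.comp_apply]
  rw [hφ m]
  exact hψ _

theorem FixesCode.exists_iterate {φ : Substitution (Fin 3)} (hφ : FixesCode ε l c φ) (n : ℕ) :
    ∃ ψ : Substitution (Fin 3), FixesCode ε l c ψ ∧ ∀ w, ψ w = φ^[n] w := by
  induction n with
  | zero => exact ⟨MonoidHom.id _, fun m => by simp, fun w => rfl⟩
  | succ n ih =>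
    obtain ⟨ψ, h1, h2⟩ := ih
    exact ⟨φ.comp ψ, h1.comp hφ, fun w => by
      rw [Function.iterate_succ_apply', MonoidHom.comp_apply, h2]⟩

theorem FixesCode.iterate_eq {ψ : Substitution (Fin 3)} (h : FixesCode ε l c ψ) {ν : ℝ}
    (hν : ∀ a, weight (shift ε) (ψ (FreeMonoid.of a)) = ν * shift ε a) (n : ℕ) :
    (T ε l c)^[(ψ (code ε l c 0 n)).length] 0 = ν * (T ε l c)^[n] 0 := by
  rw [iterate_T_eq, ← h n, weight_map, iterate_T_eq]
  simp only [hν, weight_smul]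
  ring

theorem FixesCode.code_eq {ψ : Substitution (Fin 3)} (h : FixesCode ε l c ψ) {ν : ℝ}
    (hν : ∀ a, weight (shift ε) (ψ (FreeMonoid.of a)) = ν * shift ε a) (n : ℕ) :
    code ε l c (ν * (T ε l c)^[n] 0)
      (ψ (FreeMonoid.of (letter ε l c ((T ε l c)^[n] 0)))).length =
      ψ (FreeMonoid.of (letter ε l c ((T ε l c)^[n] 0))) := by
  have h1 := h (n + 1)
  rw [code_add, map_mul, FreeMonoid.length_mul, code_add, ← h n, h.iterate_eq hν,
    code_one] at h1
  exact (mul_left_cancel h1).symm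

theorem FixesCode.exists_weight_eq (hr : IsRegular ε l c) (h0 : (0 : ℝ) ∈ Ico c (c + l))
    {ψ : Substitution (Fin 3)} (h : FixesCode ε l c ψ) :
    ∃ ν, ∀ a, weight (shift ε) (ψ (FreeMonoid.of a)) = ν * shift ε a := by
  apply hr.exists_eq_mul_shift h0 (C := 1)
  intro n
  rw [← weight_map, h n]
  have h3 := hr.iterate_mem h0 (ψ (code ε l c 0 n)).length
  rw [iterate_T_eq] at h3
  have := hr.l_lt
  rw [abs_le]
  constructor <;> linarith [h3.1, h3.2, h0.1, h0.2]

theorem FixesCode.isScaling (hr : IsRegular ε l c) (h0 : (0 : ℝ) ∈ Ico c (c + l))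
    {ψ : Substitution (Fin 3)} (h : FixesCode ε l c ψ) {ν : ℝ} (hν0 : 0 < ν) (hν1 : ν ≤ 1)
    (hν : ∀ a, weight (shift ε) (ψ (FreeMonoid.of a)) = ν * shift ε a) :
    IsScaling ε l c ψ ν := by
  refine ⟨fun y hy => ?_, fun y hy => ?_, hν⟩
  · constructor <;> nlinarith [hy.1, hy.2, h0.1, h0.2]
  · set k := (ψ (FreeMonoid.of (letter ε l c y))).length with hk
    have ht : Tendsto (fun q => ν * q) (𝓝[≥] y) (𝓝[≥] (ν * y)) := by
      apply tendsto_nhdsWithin_of_tendsto_nhds_of_eventually_within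
      · exact ((continuous_const.mul continuous_id).tendsto y).mono_left nhdsWithin_le_nhds
      · filter_upwards [self_mem_nhdsWithin] with q hq
        exact mul_le_mul_of_nonneg_left hq hν0.le
    obtain ⟨v, hv, hsub⟩ := mem_nhdsGE_iff_exists_Ico_subset.1
      ((eventually_letter_eq_right (ε := ε) (l := l) (c := c) y).and
        (ht.eventually (eventually_code_eq_right (ε := ε) (l := l) (c := c) (ν * y) k)))
    obtain ⟨n, hn⟩ := hr.exists_iterate_mem (p := y) (q := min v (c + l)) (lt_min hv hy.2)
      hy.1 (min_le_right _ _) h0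
    obtain ⟨e1, e2⟩ := hsub ⟨hn.1.le, hn.2.trans_le (min_le_left _ _)⟩
    have := h.code_eq hν n
    rw [e1, ← hk] at this
    exact e2.symm.trans this

theorem exists_isScaling_of_isPrimitive (hr : IsRegular ε l c) (h0 : (0 : ℝ) ∈ Ico c (c + l))
    {φ : Substitution (Fin 3)} (hp : IsPrimitive φ) (h : FixesCode ε l c φ) :
    ∃ ψ ν, 0 < ν ∧ ν < 1 ∧ IsScaling ε l c ψ ν := by
  obtain ⟨n, hn⟩ := hp
  obtain ⟨χ, hχ, hχn⟩ := h.exists_iterate n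
  have hχl : ∀ a, 1 < (χ (FreeMonoid.of a)).length := by
    intro a
    by_contra hlt
    rw [hχn] at hlt
    have hl : (φ^[n] (FreeMonoid.of a)).toList.toFinset = Finset.univ := by
      ext b; simpa using hn a b
    have h1 := List.toFinset_card_le (φ^[n] (FreeMonoid.of a)).toList
    rw [hl, Finset.card_univ, Fintype.card_fin] at h1
    have h2 : (φ^[n] (FreeMonoid.of a)).toList.length ≤ 1 := not_lt.1 hlt
    omega
  have hlen : ∀ w : FreeMonoid (Fin 3), w.length ≤ (χ w).length := by
    intro w
    induction w using FreeMonoid.inductionOn' with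
    | one => simp
    | of_mul a w ih =>
      have := hχl a
      rw [map_mul, FreeMonoid.length_mul, FreeMonoid.length_mul, FreeMonoid.length_of]
      omega
  obtain ⟨ν, hν⟩ := hχ.exists_weight_eq hr h0
  have hν0 : ν ≠ 0 := by
    rintro rfl
    refine weight_shift_ne_zero hr.irr (w := χ (FreeMonoid.of 0)) ?_ (by rw [hν, zero_mul])
    have := hχl 0
    omega
  have hν2 : 0 < ν * ν := mul_self_pos.2 hν0
  have hψ : FixesCode ε l c (χ.comp χ) := hχ.comp hχ
  have hw : ∀ a, weight (shift ε) (χ.comp χ (FreeMonoid.of a)) = ν * ν * shift ε a := by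
    intro a
    rw [MonoidHom.comp_apply, weight_map]
    simp only [hν, weight_smul]
    ring
  have hle : ν * ν ≤ 1 := by
    by_contra hgt
    have hcl : 0 < c + l := h0.2
    have hlt : (c + l) / (ν * ν) < c + l := by
      rw [div_lt_iff₀ hν2]; nlinarith
    obtain ⟨k, hk⟩ := hr.exists_iterate_mem hlt (by
      have : 0 < (c + l) / (ν * ν) := by positivity
      linarith [h0.1]) le_rfl h0
    have h1 := hr.iterate_mem h0 (χ.comp χ (code ε l c 0 k)).length
    rw [hψ.iterate_eq hw] at h1
    have h2 := hk.1
    rw [div_lt_iff₀ hν2] at h2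
    nlinarith [h1.2]
  refine ⟨χ.comp χ, ν * ν, hν2, lt_of_le_of_ne hle fun h1 => ?_, hψ.isScaling hr h0 hν2 hle hw⟩
  have h2 := hψ.iterate_eq hw 1
  rw [h1, one_mul] at h2
  have h3 := hr.eq_of_iterate_eq h0 h2
  rw [code_one, MonoidHom.comp_apply] at h3
  have h4 := hlen (χ (FreeMonoid.of (letter ε l c 0)))
  have h5 := hχl (letter ε l c 0)
  omega

/-! ### Recognizability -/

/-- `y` is the point of index `i` on the orbit of `ν * z` before its expected return. -/
def Covers (ε l c : ℝ) (φ : Substitution (Fin 3)) (ν y z : ℝ) (i : ℕ) : Prop :=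
  z ∈ Ico c (c + l) ∧ i < (φ (FreeMonoid.of (letter ε l c z))).length ∧
    (T ε l c)^[i] (ν * z) = y

/-- `y` is covered in two ways. -/
def DoublyCovered (ε l c : ℝ) (φ : Substitution (Fin 3)) (ν y : ℝ) : Prop :=
  ∃ z i z' i', (z, i) ≠ (z', i') ∧ Covers ε l c φ ν y z i ∧ Covers ε l c φ ν y z' i'

namespace IsScaling

variable {φ : Substitution (Fin 3)} {ν : ℝ}

theorem covers_T (hr : IsRegular ε l c) (h : IsScaling ε l c φ ν) (hν : 0 < ν) {y z : ℝ} {i : ℕ}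
    (hc : Covers ε l c φ ν y z i) :
    Covers ε l c φ ν (T ε l c y) z (i + 1) ∨
      (i + 1 = (φ (FreeMonoid.of (letter ε l c z))).length ∧
        Covers ε l c φ ν (T ε l c y) (T ε l c z) 0) := by
  obtain ⟨hz, hi, e⟩ := hc
  rcases Nat.lt_or_ge (i + 1) (φ (FreeMonoid.of (letter ε l c z))).length with h1 | h1
  · exact .inl ⟨hz, h1, by rw [Function.iterate_succ_apply', e]⟩
  · have h2 : i + 1 = (φ (FreeMonoid.of (letter ε l c z))).length := by omega
    refine .inr ⟨h2, hr.T_mem hz, Nat.pos_of_ne_zero (h.length_ne_zero hr hν.ne' _), ?_⟩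
    rw [Function.iterate_zero_apply, ← h.iterate_letter hz, ← h2, Function.iterate_succ_apply', e]

theorem doublyCovered_T (hr : IsRegular ε l c) (h : IsScaling ε l c φ ν) (hν : 0 < ν) {y : ℝ}
    (hd : DoublyCovered ε l c φ ν y) : DoublyCovered ε l c φ ν (T ε l c y) := by
  obtain ⟨z, i, z', i', hne, hc, hc'⟩ := hd
  rcases h.covers_T hr hν hc with h1 | ⟨e1, h1⟩ <;> rcases h.covers_T hr hν hc' with h2 | ⟨e2, h2⟩
  · refine ⟨_, _, _, _, ?_, h1, h2⟩
    simpa using hne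
  · exact ⟨_, _, _, _, by simp, h1, h2⟩
  · exact ⟨_, _, _, _, by simp, h1, h2⟩
  · refine ⟨_, _, _, _, fun e => hne ?_, h1, h2⟩
    have ez := hr.T_injOn hc.1 hc'.1 (Prod.ext_iff.1 e).1
    subst ez
    simp; omega

theorem eventually_covers (h : IsScaling ε l c φ ν) (hν : 0 < ν) {y z : ℝ} {i : ℕ}
    (hc : Covers ε l c φ ν y z i) :
    ∀ᶠ q in 𝓝[≥] y, Covers ε l c φ ν q (z + (q - y) / ν) i := by
  obtain ⟨hz, hi, e⟩ := hc
  have ht : Tendsto (fun q => z + (q - y) / ν) (𝓝[≥] y) (𝓝[≥] z) := by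
    apply tendsto_nhdsWithin_of_tendsto_nhds_of_eventually_within
    · have hcont : Continuous fun q => z + (q - y) / ν := by fun_prop
      simpa using (hcont.tendsto y).mono_left nhdsWithin_le_nhds
    · filter_upwards [self_mem_nhdsWithin] with q hq
      have : 0 ≤ (q - y) / ν := div_nonneg (sub_nonneg.2 hq) hν.le
      rw [mem_Ici]; linarith
  have hI : ∀ᶠ q in 𝓝[≥] z, q ∈ Ico c (c + l) := by
    filter_upwards [self_mem_nhdsWithin, mem_nhdsWithin_of_mem_nhds (Iio_mem_nhds hz.2)] with q h1 h2
    exact ⟨hz.1.trans h1, h2⟩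
  filter_upwards [ht.eventually (eventually_letter_eq_right (ε := ε) (l := l) (c := c) z),
    ht.eventually hI] with q h1 h2
  refine ⟨h2, by rwa [h1], ?_⟩
  have e1 := h.code_eq _ h2
  rw [h1, ← h.code_eq _ hz, length_code] at e1
  have e2 := code_eq_of_le e1 hi.le
  rw [iterate_T_eq, e2, ← e, iterate_T_eq, ← sub_eq_zero]
  field_simp
  rw [iterate_T_eq] at e
  linarith

theorem eventually_doublyCovered (h : IsScaling ε l c φ ν) (hν : 0 < ν) {y : ℝ}
    (hd : DoublyCovered ε l c φ ν y) : ∀ᶠ q in 𝓝[≥] y, DoublyCovered ε l c φ ν q := by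
  obtain ⟨z, i, z', i', hne, hc, hc'⟩ := hd
  filter_upwards [h.eventually_covers hν hc, h.eventually_covers hν hc'] with q h1 h2
  refine ⟨_, _, _, _, ?_, h1, h2⟩
  simpa using hne

/-- A point where the coding is discontinuous can only be covered by left end points. -/
theorem eq_endpoint_of_covers (h : IsScaling ε l c φ ν) (hν : 0 < ν) {d z : ℝ} {i : ℕ}
    (hd : ∀ᶠ q in 𝓝[<] d, letter ε l c q ≠ letter ε l c d) (hc : Covers ε l c φ ν d z i) :
    z = c ∨ z = c + l - 1 + ε ∨ z = c + ε := by
  obtain ⟨hz, hi, e⟩ := hc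
  by_contra! hne
  have ht : Tendsto (fun q => d + ν * (q - z)) (𝓝[<] z) (𝓝[<] d) := by
    apply tendsto_nhdsWithin_of_tendsto_nhds_of_eventually_within
    · have hcont : Continuous fun q => d + ν * (q - z) := by fun_prop
      simpa using (hcont.tendsto z).mono_left nhdsWithin_le_nhds
    · filter_upwards [self_mem_nhdsWithin] with q hq
      have : ν * (q - z) < 0 := mul_neg_of_pos_of_neg hν (sub_neg.2 hq)
      rw [mem_Iio]; linarith
  have hcz : c < z := lt_of_le_of_ne hz.1 (Ne.symm hne.1)
  have hl : ∀ᶠ q in 𝓝[<] z, letter ε l c q = letter ε l c z :=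
    (eventually_letter_eq hne.2.1 hne.2.2).filter_mono nhdsWithin_le_nhds
  have hIoo : ∀ᶠ q in 𝓝[<] z, q ∈ Ioo c z := Ioo_mem_nhdsLT hcz
  obtain ⟨q, ⟨h1, h2⟩, h4, h3⟩ := (((ht.eventually hd).and hl).and hIoo).exists
  have hq : q ∈ Ico c (c + l) := ⟨le_of_lt h4, lt_trans h3 hz.2⟩
  have e1 := h.code_eq _ hq
  rw [h2, ← h.code_eq _ hz, length_code] at e1
  have e2 := code_eq_of_le e1 hi.le
  have e3 := letter_eq_of_code_eq e1 hi
  apply h1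
  rw [e, iterate_T_eq, e2] at e3
  rw [iterate_T_eq] at e
  rw [← e3, ← e]
  congr 1
  ring

theorem not_doublyCovered (hr : IsRegular ε l c) (h : IsScaling ε l c φ ν) (hν : 0 < ν) {y : ℝ}
    (hy : y ∈ Ico c (c + l)) : ¬ DoublyCovered ε l c φ ν y := by
  intro hd
  obtain ⟨g1, g2, g3, g4, g5⟩ := hr.toIsExchange
  have hiter : ∀ y k, DoublyCovered ε l c φ ν y →
      DoublyCovered ε l c φ ν ((T ε l c)^[k] y) := by
    intro y k hy
    induction k with
    | zero => exact hy
    | succ k ih => rw [Function.iterate_succ_apply']; exact h.doublyCovered_T hr hν ih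
  obtain ⟨v, hv, hsub⟩ := mem_nhdsGE_iff_exists_Ico_subset.1 (h.eventually_doublyCovered hν hd)
  have hall : ∀ d ∈ Ico c (c + l), DoublyCovered ε l c φ ν d := by
    intro d hdI
    obtain ⟨z, hz, k, rfl⟩ := hr.exists_iterate_eq_of_mem_Ioo (p := y) (q := min v (c + l))
      (lt_min hv hy.2) hy.1 (min_le_right _ _) hdI
    exact hiter _ _ (hsub ⟨hz.1.le, hz.2.trans_le (min_le_left _ _)⟩)
  have hdisc1 : ∀ᶠ q in 𝓝[<] (c + l - 1 + ε), letter ε l c q ≠ letter ε l c (c + l - 1 + ε) := by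
    filter_upwards [self_mem_nhdsWithin] with q hq
    rw [letter_lt hq, letter_mid le_rfl (by linarith)]
    decide
  have hdisc2 : ∀ᶠ q in 𝓝[<] (c + ε), letter ε l c q ≠ letter ε l c (c + ε) := by
    filter_upwards [self_mem_nhdsWithin, mem_nhdsWithin_of_mem_nhds
      (Ioi_mem_nhds (show c + l - 1 + ε < c + ε by linarith))] with q hq hq'
    rw [letter_mid (le_of_lt hq') hq, hr.letter_ge le_rfl]
    decide
  have hne : ∀ {d z i z' i'}, (z, i) ≠ (z', i') → Covers ε l c φ ν d z i →
      Covers ε l c φ ν d z' i' → z ≠ z' := by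
    rintro d z i z' i' hne ⟨hz, -, e⟩ ⟨-, -, e'⟩ rfl
    exact hne (by rw [hr.eq_of_iterate_eq (h.mul_mem z hz) (e.trans e'.symm)])
  have hsep : ∀ {z i z' i'}, Covers ε l c φ ν (c + l - 1 + ε) z i →
      Covers ε l c φ ν (c + ε) z' i' → z ≠ z' := by
    rintro z i z' i' ⟨hz, -, e⟩ ⟨-, -, e'⟩ rfl
    rcases le_total i i' with hle | hle <;> obtain ⟨k, rfl⟩ := Nat.exists_eq_add_of_le hle
    · rw [add_comm, Function.iterate_add_apply, e] at e'
      exact hr.iterate_left_ne _ e'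
    · rw [add_comm, Function.iterate_add_apply, e'] at e
      exact hr.iterate_right_ne _ e
  obtain ⟨z₁, i₁, z₂, i₂, n12, h1, h2⟩ := hall (c + l - 1 + ε) ⟨by linarith, by linarith⟩
  obtain ⟨z₃, i₃, z₄, i₄, n34, h3, h4⟩ := hall (c + ε) ⟨by linarith, by linarith⟩
  have m1 := h.eq_endpoint_of_covers hν hdisc1 h1
  have m2 := h.eq_endpoint_of_covers hν hdisc1 h2
  have m3 := h.eq_endpoint_of_covers hν hdisc2 h3
  have m4 := h.eq_endpoint_of_covers hν hdisc2 h4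
  have d12 := hne n12 h1 h2
  have d34 := hne n34 h3 h4
  have d13 := hsep h1 h3
  have d14 := hsep h1 h4
  have d23 := hsep h2 h3
  have d24 := hsep h2 h4
  clear hne hsep h1 h2 h3 h4 hall hiter hdisc1 hdisc2 n12 n34 hsub hd
  generalize c + l - 1 + ε = b₁ at *
  generalize c + ε = b₂ at *
  grind

/-! ### The interval of a scaling substitution -/

theorem returnTime_eq (hr : IsRegular ε l c) (h : IsScaling ε l c φ ν) (hν : 0 < ν) {z : ℝ}
    (hz : z ∈ Ico c (c + l)) :
    returnTime ε l c ((fun x => ν * x) '' Ico c (c + l)) (ν * z) =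
      (φ (FreeMonoid.of (letter ε l c z))).length := by
  have hpos := Nat.pos_of_ne_zero (h.length_ne_zero hr hν.ne' (letter ε l c z))
  apply IsLeast.csInf_eq
  constructor
  · exact ⟨hpos, _, hr.T_mem hz, (h.iterate_letter hz).symm⟩
  · rintro i ⟨hi, z', hz', e⟩
    by_contra hlt
    refine h.not_doublyCovered hr hν (h.mul_mem z' hz') ⟨z, i, z', 0, ?_,
      ⟨hz, not_le.1 hlt, e.symm⟩, hz', Nat.pos_of_ne_zero (h.length_ne_zero hr hν.ne' _), rfl⟩
    simp; omega

theorem P1_image (hr : IsRegular ε l c) (h : IsScaling ε l c φ ν) (hν : 0 < ν) (hν1 : ν < 1) :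
    P1 ε l c ((fun x => ν * x) '' Ico c (c + l)) := by
  refine ⟨ν, ⟨by linarith, hν1⟩, hν.ne', rfl, ?_⟩
  rintro _ ⟨z, hz, rfl⟩
  simp only [firstReturn]
  rw [h.returnTime_eq hr hν hz, h.iterate_letter hz, mul_div_cancel_left₀ _ hν.ne']

theorem P2_image (hr : IsRegular ε l c) (h : IsScaling ε l c φ ν) (hν : 0 < ν) :
    P2 ε l c ((fun x => ν * x) '' Ico c (c + l)) := by
  have hname : ∀ z ∈ Ico c (c + l), returnName ε l c ((fun x => ν * x) '' Ico c (c + l)) (ν * z) =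
      (φ (FreeMonoid.of (letter ε l c z))).toList := by
    intro z hz
    rw [← toList_code_returnTime, h.returnTime_eq hr hν hz, h.code_eq z hz]
  have hset : returnName ε l c ((fun x => ν * x) '' Ico c (c + l)) ''
      ((fun x => ν * x) '' Ico c (c + l)) = range fun a => (φ (FreeMonoid.of a)).toList := by
    rw [image_image]
    ext w
    constructor
    · rintro ⟨z, hz, rfl⟩
      exact ⟨_, (hname z hz).symm⟩
    · rintro ⟨a, rfl⟩
      obtain ⟨z, hz, rfl⟩ := hr.exists_letter_eq a
      exact ⟨z, hz, hname z hz⟩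
  rw [P2, hset, ncard_range_of_injective]
  · simp
  · intro a b hab
    have hab' : φ (FreeMonoid.of a) = φ (FreeMonoid.of b) := hab
    have h3 := h.weight_eq a
    rw [hab', h.weight_eq b] at h3
    exact (shift_injective hr.pos hr.lt_one (mul_left_cancel₀ hν.ne' h3)).symm

end IsScaling

theorem exists_interval_of_substitution (hr : IsRegular ε l c) (h0 : (0 : ℝ) ∈ Ico c (c + l))
    {u : ℤ → Fin 3} (hu : IsCoding ε l c u)
    (h : ∃ φ : Substitution (Fin 3), IsPrimitive φ ∧ IsInvariant φ u) :
    ∃ J : Set ℝ, (∃ a b : ℝ, a < b ∧ J = Ico a b) ∧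
      J ⊆ Ico c (c + l) ∧ (0 : ℝ) ∈ J ∧ P1 ε l c J ∧ P2 ε l c J := by
  obtain ⟨φ, hp, hi⟩ := h
  obtain ⟨ψ, ν, hν0, hν1, hs⟩ := exists_isScaling_of_isPrimitive hr h0 hp (hi.fixesCode hu)
  refine ⟨(fun x => ν * x) '' Ico c (c + l), ⟨ν * c, ν * (c + l), ?_, ?_⟩, ?_, ⟨0, h0, by simp⟩,
    hs.P1_image hr hν0 hν1, hs.P2_image hr hν0⟩
  · have := hr.lt_l
    have := hr.pos
    nlinarith
  · exact image_mul_left_Ico hν0 _ _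
  · rintro _ ⟨z, hz, rfl⟩
    exact hs.mul_mem z hz

end ThreeIet

/-- The equivalence is stated for intervals `J = [a, b)`, and also for intervals `J` of either
half-open kind (for a ratio `ν < 0`, the set `ν[c, c+l)` is open from the left and closed from
the right). -/
theorem propositionp (ε l c : ℝ) (hε : ε ∈ Ioo (0 : ℝ) 1) (hl : l < 1) (hl' : max (1 - ε) ε < l)
    (hc : (0 : ℝ) ∈ Ico c (c + l)) (u : ℤ → Fin 3)
    (hu : ThreeIet.IsNondegenerateWord ε l c u) :
    ((∃ φ : ThreeIet.Substitution (Fin 3), ThreeIet.IsPrimitive φ ∧ ThreeIet.IsInvariant φ u) ↔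
      ∃ J : Set ℝ, (∃ a b : ℝ, a < b ∧ J = Ico a b) ∧
        J ⊆ Ico c (c + l) ∧ (0 : ℝ) ∈ J ∧ ThreeIet.P1 ε l c J ∧ ThreeIet.P2 ε l c J) ∧
    ((∃ φ : ThreeIet.Substitution (Fin 3), ThreeIet.IsPrimitive φ ∧ ThreeIet.IsInvariant φ u) ↔
      ∃ J : Set ℝ, (∃ a b : ℝ, a < b ∧ (J = Ico a b ∨ J = Ioc a b)) ∧
        J ⊆ Ico c (c + l) ∧ (0 : ℝ) ∈ J ∧ ThreeIet.P1 ε l c J ∧ ThreeIet.P2 ε l c J) := by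
  obtain ⟨h1, h2⟩ := max_lt_iff.1 hl'
  have he : ThreeIet.IsExchange ε l c := ⟨hε.1, hε.2, hl, h1, h2⟩
  have hr := he.isRegular hu.1
  refine ⟨⟨ThreeIet.exists_interval_of_substitution hr hc hu.2, ?_⟩, fun h => ?_, ?_⟩
  · rintro ⟨J, -, hJ, -, hP1, hP2⟩
    exact ThreeIet.exists_substitution_of_interval hr hu.2 hJ hP1 hP2
  · obtain ⟨J, ⟨a, b, hab, e⟩, hJ⟩ := ThreeIet.exists_interval_of_substitution hr hc hu.2 h
    exact ⟨J, ⟨a, b, hab, .inl e⟩, hJ⟩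
  · rintro ⟨J, -, hJ, -, hP1, hP2⟩
    exact ThreeIet.exists_substitution_of_interval hr hu.2 hJ hP1 hP2
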